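/- Let $M$ be a closed manifold (compact, connected, Hausdorff, without boundary) and let $\mathcal F$ be a continuous codimension-one foliation of $M$ with Riemannian leaves of dimension $n$. That is, $M$ is covered by charts with values in $\mathbb R^n\times\mathbb R$ whose changes of coordinates have locally the form $(x,y)\mapsto(a(x,y),h(y))$, where $a$ is of class $C^2$ in $x$ and its derivatives in $x$ of order at most $2$ are continuous in $(x,y)$; and the leaves carry Riemannian metrics whose coefficients in these charts are of class $C^1$ in $x$, the coefficients and their first derivatives in $x$ being continuous in $(x,y)$. (This covers in particular $C^r$ leaves and $C^r$ leafwise metrics, $2\le r\le\infty$, varying continuously on $M$.) A function $f:M\to\mathbb R$ is called leafwise harmonic if it is continuous on $M$ and its restriction to every leaf is of class $C^2$ and is annihilated by the Laplace–Beltrami operator of the leaf. Suppose that $\mathcal F$ is $\mathbb R$-covered, that is, the space of leaves $\widetilde M/\widetilde{\mathcal F}$ of the lift $\widetilde{\mathcal F}$ of $\mathcal F$ to the universal cover $\widetilde M$ of $M$, with the quotient topology, is homeomorphic to $\mathbb R$; and suppose that no leaf of $\mathcal F$ is compact. Then every leafwise harmonic function is constant on $M$. In particular $(M,\mathcal F)$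 has the Liouville property: every leafwise harmonic function is constant on each leaf. -/

import Mathlib

open scoped Topology

universe u

/-- The model space `ℝⁿ` of the leaves. -/
abbrev LeafModel (n : ℕ) : Type := EuclideanSpace ℝ (Fin n)

/-- `f(x, y)` is of class `C^k` in the leaf variable `x` on the (open) set `U`, and its derivatives
in `x` of order at most `k` are continuous in `(x, y)`. -/
def LeafwiseContDiffOn {n : ℕ} {W : Type*} [NormedAddCommGroup W] [NormedSpace ℝ W]
    (k : ℕ) (f : LeafModel n × ℝ → W) (U : Set (LeafModel n × ℝ)) : Prop :=
  (∀ q ∈ U, ContDiffAt ℝ k (fun x => f (x, q.2)) q.1) ∧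
    ∀ j ≤ k, ContinuousOn (fun q => iteratedFDeriv ℝ j (fun x => f (x, q.2)) q.1) U

theorem LeafwiseContDiffOn.congr_mono {n : ℕ} {W : Type*} [NormedAddCommGroup W]
    [NormedSpace ℝ W] {k : ℕ} {f g : LeafModel n × ℝ → W} {U U' : Set (LeafModel n × ℝ)}
    (hf : LeafwiseContDiffOn k f U) (hU' : IsOpen U') (hsub : U' ⊆ U) (hfg : Set.EqOn g f U') :
    LeafwiseContDiffOn k g U' := by
  have key : ∀ q ∈ U', (fun x => g (x, q.2)) =ᶠ[𝓝 q.1] (fun x => f (x, q.2)) := by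
    intro q hq
    have hc : ContinuousAt (fun x : LeafModel n => (x, q.2)) q.1 := by fun_prop
    filter_upwards [hc.preimage_mem_nhds (hU'.mem_nhds hq)] with x hx
    exact hfg hx
  refine ⟨fun q hq => (hf.1 q (hsub hq)).congr_of_eventuallyEq (key q hq), fun j hj => ?_⟩
  refine ((hf.2 j hj).mono hsub).congr fun q hq => ?_
  exact ((key q hq).iteratedFDeriv ℝ j).eq_of_nhds

/-- A continuous codimension-one foliation of `M` (without boundary) with leaves of dimension `n`
and of class `C²`, given by a foliated atlas: charts with values in `ℝⁿ × ℝ` whose changes of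
coordinates are locally of the form `(x, y) ↦ (a(x, y), h(y))`, with `a` of class `C²` in `x` and
its derivatives in `x` of order at most two continuous in `(x, y)`. -/
structure CodimOneFoliation (n : ℕ) (M : Type u) [TopologicalSpace M] where
  atlas : Set (OpenPartialHomeomorph M (LeafModel n × ℝ))
  covers : ∀ x : M, ∃ φ ∈ atlas, x ∈ φ.source
  transverse : ∀ φ ∈ atlas, ∀ ψ ∈ atlas, ∀ p ∈ (φ.symm.trans ψ).source,
    ∃ h : ℝ → ℝ, ∀ᶠ q in 𝓝 p, (φ.symm.trans ψ q).2 = h q.2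
  leafwise : ∀ φ ∈ atlas, ∀ ψ ∈ atlas,
    LeafwiseContDiffOn 2 (fun q => (φ.symm.trans ψ q).1) (φ.symm.trans ψ).source

namespace CodimOneFoliation

variable {n : ℕ} {M : Type u} [TopologicalSpace M]

/-- The leaf topology: it is generated by the open subsets of the plaques. -/
@[reducible]
def leafTopology (F : CodimOneFoliation n M) : TopologicalSpace M :=
  TopologicalSpace.generateFrom
    {P | ∃ φ ∈ F.atlas, ∃ W : Set (LeafModel n), IsOpen W ∧ ∃ y : ℝ,
      P = {x | x ∈ φ.source ∧ (φ x).1 ∈ W ∧ (φ x).2 = y}}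

/-- Two points are equivalent if they lie on the same leaf; the leaves are the connected
components of `M` in the leaf topology. -/
def leafSetoid (F : CodimOneFoliation n M) : Setoid M :=
  @connectedComponentSetoid M F.leafTopology

/-- The leaf through `x`. -/
def leaf (F : CodimOneFoliation n M) (x : M) : Set M :=
  @connectedComponent M F.leafTopology x

/-- The leaf through `x` is compact, as a manifold (that is, in the leaf topology). -/
def IsCompactLeaf (F : CodimOneFoliation n M) (x : M) : Prop :=
  @IsCompact M F.leafTopology (F.leaf x)

/-- The space of leaves, with the quotient of the topology of `M`. -/
abbrev LeafSpace (F : CodimOneFoliation n M) : Type u := Quotient F.leafSetoid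

/-- The lift of a foliation along a local homeomorphism `p`: its charts are the `φ ∘ p`, on the
open sets on which this is a chart, with `φ` a chart of the given foliation. -/
def lift {E : Type u} [TopologicalSpace E] (F : CodimOneFoliation n M) (p : E → M)
    (hp : IsLocalHomeomorph p) : CodimOneFoliation n E where
  atlas := {χ | ∃ φ ∈ F.atlas, Set.MapsTo p χ.source φ.source ∧ Set.EqOn χ (φ ∘ p) χ.source}
  covers := by
    intro x
    obtain ⟨e, hxe, he⟩ := hp x
    obtain ⟨φ, hφ, hx⟩ := F.covers (p x)
    subst he
    refine ⟨e.trans φ, ⟨φ, hφ, ?_, ?_⟩, ?_⟩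
    · intro z hz
      simp only [OpenPartialHomeomorph.trans_source] at hz
      exact hz.2
    · intro z _
      rfl
    · simp only [OpenPartialHomeomorph.trans_source]
      exact ⟨hxe, hx⟩
  transverse := by
    rintro χ ⟨φ, hφ, hχφ, hχ⟩ ω ⟨ψ, hψ, hωψ, hω⟩ a ha
    have key : ∀ q ∈ (χ.symm.trans ω).source,
        q ∈ (φ.symm.trans ψ).source ∧ χ.symm.trans ω q = φ.symm.trans ψ q := by
      intro q hq
      simp only [OpenPartialHomeomorph.trans_source, OpenPartialHomeomorph.symm_source,
        Set.mem_inter_iff, Set.mem_preimage] at hq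
      have hz := χ.map_target hq.1
      have h1 : φ (p (χ.symm q)) = q := by
        rw [← χ.right_inv hq.1, χ.left_inv hz]; exact (hχ hz).symm
      have h2 : φ.symm q = p (χ.symm q) := by
        rw [← φ.left_inv (hχφ hz), h1]
      refine ⟨?_, ?_⟩
      · simp only [OpenPartialHomeomorph.trans_source, OpenPartialHomeomorph.symm_source,
          Set.mem_inter_iff, Set.mem_preimage, h2]
        exact ⟨h1 ▸ φ.map_source (hχφ hz), hωψ hq.2⟩
      · simp only [OpenPartialHomeomorph.coe_trans, Function.comp_apply, h2]
        exact hω hq.2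
    obtain ⟨h, hh⟩ := F.transverse φ hφ ψ hψ a (key a ha).1
    refine ⟨h, ?_⟩
    filter_upwards [hh, (χ.symm.trans ω).open_source.mem_nhds ha] with q hq hq'
    rw [(key q hq').2, hq]
  leafwise := by
    rintro χ ⟨φ, hφ, hχφ, hχ⟩ ω ⟨ψ, hψ, hωψ, hω⟩
    have key : ∀ q ∈ (χ.symm.trans ω).source,
        q ∈ (φ.symm.trans ψ).source ∧ χ.symm.trans ω q = φ.symm.trans ψ q := by
      intro q hq
      simp only [OpenPartialHomeomorph.trans_source, OpenPartialHomeomorph.symm_source,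
        Set.mem_inter_iff, Set.mem_preimage] at hq
      have hz := χ.map_target hq.1
      have h1 : φ (p (χ.symm q)) = q := by
        rw [← χ.right_inv hq.1, χ.left_inv hz]; exact (hχ hz).symm
      have h2 : φ.symm q = p (χ.symm q) := by
        rw [← φ.left_inv (hχφ hz), h1]
      refine ⟨?_, ?_⟩
      · simp only [OpenPartialHomeomorph.trans_source, OpenPartialHomeomorph.symm_source,
          Set.mem_inter_iff, Set.mem_preimage, h2]
        exact ⟨h1 ▸ φ.map_source (hχφ hz), hωψ hq.2⟩
      · simp only [OpenPartialHomeomorph.coe_trans, Function.comp_apply, h2]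
        exact hω hq.2
    exact (F.leafwise φ hφ ψ hψ).congr_mono (χ.symm.trans ω).open_source
      (fun q hq => (key q hq).1) (fun q hq => congrArg Prod.fst (key q hq).2)

/-- `F` is `ℝ`-covered: the space of leaves of the lift of `F` to the universal cover of `M` is
homeomorphic to `ℝ`. The universal cover is a simply connected covering space of `M`; it is unique
up to isomorphism. -/
def IsRCovered (F : CodimOneFoliation n M) : Prop :=
  ∃ (E : Type u) (_ : TopologicalSpace E) (_ : SimplyConnectedSpace E) (p : E → M)
    (hp : IsCoveringMap p), Nonempty ((F.lift p hp.isLocalHomeomorph).LeafSpace ≃ₜ ℝ)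

end CodimOneFoliation

noncomputable section

/-- The partial derivative `∂ᵢ u` at `x`. -/
def leafPartial {n : ℕ} (i : Fin n) (u : LeafModel n → ℝ) (x : LeafModel n) : ℝ :=
  fderiv ℝ u x (EuclideanSpace.single i 1)

/-- The Christoffel symbol `Γᵏᵢⱼ` at `x` of the metric `G`. -/
def christoffelSymbol {n : ℕ} (G : LeafModel n → Matrix (Fin n) (Fin n) ℝ) (x : LeafModel n)
    (k i j : Fin n) : ℝ :=
  (1 / 2) * ∑ l, (G x)⁻¹ k l *
    (leafPartial i (fun z => G z j l) x + leafPartial j (fun z => G z i l) x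
      - leafPartial l (fun z => G z i j) x)

/-- The Laplace–Beltrami operator of the metric `G` in coordinates, the trace of the covariant
Hessian: `Δu = gⁱʲ (∂ᵢ∂ⱼu - Γᵏᵢⱼ ∂ₖu)`. -/
def laplaceBeltrami {n : ℕ} (G : LeafModel n → Matrix (Fin n) (Fin n) ℝ) (u : LeafModel n → ℝ)
    (x : LeafModel n) : ℝ :=
  ∑ i, ∑ j, (G x)⁻¹ i j *
    (leafPartial i (leafPartial j u) x - ∑ k, christoffelSymbol G x k i j * leafPartial k u x)

/-- The Jacobian matrix at `q`, in the leaf direction, of a change of coordinates `τ`. -/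
def leafJacobian {n : ℕ} (τ : LeafModel n × ℝ → LeafModel n × ℝ) (q : LeafModel n × ℝ) :
    Matrix (Fin n) (Fin n) ℝ :=
  Matrix.of fun k i => leafPartial i (fun x => (τ (x, q.2)).1 k) q.1

/-- A Riemannian metric on the leaves of `F`: positive definite symmetric matrices of coefficients
in each chart, of class `C¹` along the leaves, continuous on `M` together with their first leafwise
derivatives, and transforming as a covariant 2-tensor. -/
structure LeafwiseMetric {n : ℕ} {M : Type u} [TopologicalSpace M]
    (F : CodimOneFoliation n M) where
  coeff : OpenPartialHomeomorph M (LeafModel n × ℝ) → LeafModel n × ℝ → Matrix (Fin n) (Fin n) ℝ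
  posDef : ∀ φ ∈ F.atlas, ∀ q ∈ φ.target, (coeff φ q).PosDef
  regular : ∀ φ ∈ F.atlas, ∀ i j, LeafwiseContDiffOn 1 (fun q => coeff φ q i j) φ.target
  compatible : ∀ φ ∈ F.atlas, ∀ ψ ∈ F.atlas, ∀ q ∈ (φ.symm.trans ψ).source,
    coeff φ q = (leafJacobian (φ.symm.trans ψ) q).transpose * coeff ψ (φ.symm.trans ψ q) *
      leafJacobian (φ.symm.trans ψ) q

end

namespace LeafwiseMetric

variable {n : ℕ} {M : Type u} [TopologicalSpace M] {F : CodimOneFoliation n M}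

/-- `f` is continuous on `M` and, on every leaf, of class `C²` and harmonic. -/
def IsLeafwiseHarmonic (g : LeafwiseMetric F) (f : M → ℝ) : Prop :=
  Continuous f ∧ ∀ φ ∈ F.atlas, ∀ q ∈ φ.target,
    ContDiffAt ℝ 2 (fun x => f (φ.symm (x, q.2))) q.1 ∧
      laplaceBeltrami (fun x => g.coeff φ (x, q.2)) (fun x => f (φ.symm (x, q.2))) q.1 = 0

/-- Every leafwise harmonic function is constant on each leaf. -/
def LiouvilleProperty (g : LeafwiseMetric F) : Prop :=
  ∀ f : M → ℝ, g.IsLeafwiseHarmonic f → ∀ x : M, ∀ y ∈ F.leaf x, f y = f x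

end LeafwiseMetric

/-! Let a leafwise harmonic `f` be nonconstant, and let `A` and `B` be the closed disjoint sets
where it attains its maximum and its minimum. By the strong maximum principle both are clopen in the
leaf topology, hence unions of leaves.

In the leaf space `ℝ` of the lifted foliation they become disjoint closed sets `A₁` and `B₁`,
preserved by the deck transformations. The points of `A₁` from which one reaches `B₁` without
meeting any other point of `A₁ ∪ B₁` on the way form a set `D`. It is nonempty and locally finite
because `A₁` and `B₁` are closed and disjoint. It is deck invariant because its definition is purely
topological and mentions no orientation of the line.

The leaves in `D` therefore project to a closed set `K` of `M`, compact since `M` is. As `D` is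
locally finite and a small transversal meets each lifted leaf at most once, `K` has the same
topology as a subset of `M` and in the leaf topology. So `K` is leafwise compact, and each leaf in
it is a compact leaf, which was excluded (`exists_isCompactLeaf`).

The maximum principle is proved by Hopf's barrier argument in a plaque
(`eventually_eq_of_laplaceBeltrami_eq_zero`). -/

/-! ### Real line: transition points of two closed sets, and locally open maps -/

/-- The points of `A` that are joined to a point of `B` by a connected set which meets `A ∪ B`
nowhere else. -/
def transitionSet {X : Type*} [TopologicalSpace X] (A B : Set X) : Set X :=
  {a | a ∈ A ∧ ∃ b ∈ B, ∃ S : Set X, IsPreconnected S ∧ a ∈ S ∧ b ∈ S ∧ S ∩ (A ∪ B) ⊆ {a, b}}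

/-- Continuous images of connected sets are connected, and since `A` and `B` are full preimages, `σ
'' S` meets `A' ∪ B'` only at images of points of `S ∩ (A ∪ B)`. Neither injectivity nor
monotonicity of `σ` is needed. -/
theorem map_mem_transitionSet {X Y : Type*} [TopologicalSpace X] [TopologicalSpace Y]
    {A B : Set X} {A' B' : Set Y} {σ : X → Y} (hσ : Continuous σ) (hA : σ ⁻¹' A' = A)
    (hB : σ ⁻¹' B' = B) {a : X} (ha : a ∈ transitionSet A B) : σ a ∈ transitionSet A' B' := by
  subst hA hB
  obtain ⟨haA, b, hb, S, hS, haS, hbS, hsub⟩ := ha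
  refine ⟨haA, σ b, hb, σ '' S, hS.image σ hσ.continuousOn, ⟨a, haS, rfl⟩, ⟨b, hbS, rfl⟩, ?_⟩
  rintro _ ⟨⟨s, hs, rfl⟩, hs'⟩
  rcases hsub ⟨hs, hs'⟩ with rfl | rfl
  · exact Or.inl rfl
  · exact Or.inr rfl

theorem exists_Icc_inter_union_subset_pair {A B : Set ℝ} (hA : IsClosed A) (hB : IsClosed B)
    {a₀ b₀ : ℝ} (ha₀ : a₀ ∈ A) (hb₀ : b₀ ∈ B) (h : a₀ ≤ b₀) :
    ∃ a ∈ A, ∃ b ∈ B, a ≤ b ∧ Set.Icc a b ∩ (A ∪ B) ⊆ {a, b} := by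
  -- Take the last point of `A` in `[a₀, b₀]`, then the first point of `B` after it.
  obtain ⟨a, ⟨haA, ha⟩, hamax⟩ := (isCompact_Icc.inter_left hA).exists_isGreatest
    ⟨a₀, ha₀, Set.left_mem_Icc.2 h⟩
  obtain ⟨b, ⟨hbB, hb⟩, hbmin⟩ := (isCompact_Icc.inter_left hB).exists_isLeast
    ⟨b₀, hb₀, Set.right_mem_Icc.2 ha.2⟩
  refine ⟨a, haA, b, hbB, hb.1, ?_⟩
  rintro x ⟨hx, hxA | hxB⟩
  · exact Or.inl (le_antisymm (hamax ⟨hxA, ha.1.trans hx.1, hx.2.trans hb.2⟩) hx.1)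
  · exact Or.inr (le_antisymm hx.2 (hbmin ⟨hxB, hx.1, hx.2.trans hb.2⟩))

theorem transitionSet_nonempty {A B : Set ℝ} (hA : IsClosed A) (hB : IsClosed B)
    (hA' : A.Nonempty) (hB' : B.Nonempty) : (transitionSet A B).Nonempty := by
  obtain ⟨a₀, ha₀⟩ := hA'
  obtain ⟨b₀, hb₀⟩ := hB'
  rcases le_total a₀ b₀ with h | h
  · obtain ⟨a, ha, b, hb, hab, hsub⟩ := exists_Icc_inter_union_subset_pair hA hB ha₀ hb₀ h
    exact ⟨a, ha, b, hb, _, isPreconnected_Icc, Set.left_mem_Icc.2 hab, Set.right_mem_Icc.2 hab,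
      hsub⟩
  · obtain ⟨b, hb, a, ha, hab, hsub⟩ := exists_Icc_inter_union_subset_pair hB hA hb₀ ha₀ h
    refine ⟨a, ha, b, hb, _, isPreconnected_Icc, Set.right_mem_Icc.2 hab, Set.left_mem_Icc.2 hab,
      ?_⟩
    rwa [Set.union_comm, Set.pair_comm]

/-- Near `r ∈ A` there is a ball free of `B`. A transition point `d ≠ r` in it must reach `B` beyond
the ball without crossing `r`, so no further point of `A` lies between `d` and the end of the ball
on that side. Hence each side of `r` carries at most one transition point in the ball. The property
holds at every `r`, also outside the transition set, so that it yields closedness as well as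
discreteness. -/
theorem transitionSet_locally_subsingleton {A B : Set ℝ} (hA : IsClosed A) (hB : IsClosed B)
    (hAB : Disjoint A B) (r : ℝ) : ∀ᶠ d in 𝓝 r, d ∈ transitionSet A B → d = r := by
  by_cases hr : r ∈ A
  swap
  · filter_upwards [hA.isOpen_compl.mem_nhds hr] with d hd hd'
    exact absurd hd'.1 hd
  have hrB : r ∉ B := fun h => Set.disjoint_left.1 hAB hr h
  obtain ⟨ε, hε, hεB⟩ := Metric.mem_nhds_iff.1 (hB.isOpen_compl.mem_nhds hrB)
  rw [Real.ball_eq_Ioo] at hεB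
  -- an element of the transition set in the ball is joined to a point beyond the ball
  have key : ∀ d ∈ transitionSet A B, d ∈ Set.Ioo (r - ε) (r + ε) → d ≠ r →
      (r < d ∧ ∀ x ∈ A, d < x → r + ε ≤ x) ∨ (d < r ∧ ∀ x ∈ A, x < d → x ≤ r - ε) := by
    rintro d ⟨hdA, b, hb, S, hS, hdS, hbS, hsub⟩ hd hdr
    have hbε : b ≤ r - ε ∨ r + ε ≤ b := by
      by_contra! hcon
      exact hεB ⟨hcon.1, hcon.2⟩ hb
    have hnot : ∀ x ∈ A, x ∈ Set.uIcc d b → x = d := by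
      intro x hx hxS
      rcases hsub ⟨hS.ordConnected.uIcc_subset hdS hbS hxS, Or.inl hx⟩ with h | h
      · exact h
      · exact absurd hb (Set.disjoint_left.1 hAB (h ▸ hx))
    have hrd : r ∉ Set.uIcc d b := fun h => hdr (hnot r hr h).symm
    rcases hbε with hbε | hbε
    · right
      have hdr' : d < r := by
        by_contra! hcon
        exact hrd (Set.mem_uIcc.2 (Or.inr ⟨by linarith, hcon⟩))
      refine ⟨hdr', fun x hx hxd => ?_⟩
      by_contra! hcon
      exact hxd.ne (hnot x hx (Set.mem_uIcc.2 (Or.inr ⟨by linarith, hxd.le⟩)))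
    · left
      have hdr' : r < d := by
        by_contra! hcon
        exact hrd (Set.mem_uIcc.2 (Or.inl ⟨hcon, by linarith⟩))
      refine ⟨hdr', fun x hx hxd => ?_⟩
      by_contra! hcon
      exact hxd.ne' (hnot x hx (Set.mem_uIcc.2 (Or.inl ⟨hxd.le, by linarith⟩)))
  have hright : ∃ c > r, ∀ d ∈ transitionSet A B, r < d → c ≤ d := by
    by_cases hex : ∃ d ∈ transitionSet A B, r < d ∧ d < r + ε
    · obtain ⟨d, hd, hrd, hdε⟩ := hex
      refine ⟨d, hrd, fun e he hre => ?_⟩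
      by_contra! hed
      rcases key e he ⟨by linarith, by linarith⟩ hre.ne' with h | h
      · have := h.2 d hd.1 hed
        linarith
      · linarith [h.1]
    · push Not at hex
      exact ⟨r + ε, by linarith, hex⟩
  have hleft : ∃ c < r, ∀ d ∈ transitionSet A B, d < r → d ≤ c := by
    by_cases hex : ∃ d ∈ transitionSet A B, d < r ∧ r - ε < d
    · obtain ⟨d, hd, hrd, hdε⟩ := hex
      refine ⟨d, hrd, fun e he hre => ?_⟩
      by_contra! hed
      rcases key e he ⟨by linarith, by linarith⟩ hre.ne with h | h
      · linarith [h.1]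
      · have := h.2 d hd.1 hed
        linarith
    · push Not at hex
      exact ⟨r - ε, by linarith, hex⟩
  obtain ⟨c, hc, hc'⟩ := hright
  obtain ⟨c₁, hc₁, hc₁'⟩ := hleft
  filter_upwards [Ioo_mem_nhds hc₁ hc] with d hd hdD
  rcases lt_trichotomy d r with h | h | h
  · exact absurd hd.1 (hc₁' d hdD h).not_gt
  · exact h
  · exact absurd hd.2 (hc' d hdD h).not_gt

theorem isClosed_of_locally_subsingleton {D : Set ℝ} (h : ∀ r, ∀ᶠ d in 𝓝 r, d ∈ D → d = r) :
    IsClosed D := by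
  refine isClosed_iff_clusterPt.2 fun r hr => ?_
  obtain ⟨d, hd, hdD⟩ := (clusterPt_principal_iff_frequently.1 hr).and_eventually (h r) |>.exists
  exact hdD hd ▸ hd

/-- A continuous map on an interval which is locally open has no local extrema, so it is
injective. -/
theorem injOn_Ioo_of_continuousOn_of_map_nhds {c : ℝ → ℝ} {a b : ℝ}
    (hc : ContinuousOn c (Set.Ioo a b))
    (ho : ∀ y ∈ Set.Ioo a b, 𝓝 (c y) ≤ Filter.map c (𝓝 y)) : Set.InjOn c (Set.Ioo a b) := by
  have hext : ∀ y ∈ Set.Ioo a b, ¬ IsLocalExtr c y := by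
    rintro y hy (h | h)
    · have h1 : ∀ᶠ z in 𝓝 (c y), c y ≤ z := ho y hy h
      obtain ⟨z, hz, hz'⟩ := (h1.and_frequently (frequently_lt_nhds (c y))).exists
      exact hz.not_gt hz'
    · have h1 : ∀ᶠ z in 𝓝 (c y), z ≤ c y := ho y hy h
      obtain ⟨z, hz, hz'⟩ := (h1.and_frequently (frequently_gt_nhds (c y))).exists
      exact hz.not_gt hz'
  have hlt : ∀ y ∈ Set.Ioo a b, ∀ z ∈ Set.Ioo a b, y < z → c y ≠ c z := by
    intro y hy z hz hyz heq
    obtain ⟨w, hw, hw'⟩ := exists_isLocalExtr_Ioo hyz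
      (hc.mono (Set.Icc_subset_Ioo hy.1 hz.2)) heq
    exact hext w ⟨hy.1.trans hw.1, hw.2.trans hz.2⟩ hw'
  intro y hy z hz heq
  rcases lt_trichotomy y z with h | h | h
  · exact absurd heq (hlt y hy z hz h)
  · exact h
  · exact absurd heq.symm (hlt z hz y hy h)

/-! ### Leaf topology, plaques and the projection to the leaf space -/

namespace CodimOneFoliation

variable {n : ℕ} {M : Type u} [TopologicalSpace M] (F : CodimOneFoliation n M)

theorem isOpen_plaque {φ : OpenPartialHomeomorph M (LeafModel n × ℝ)} (hφ : φ ∈ F.atlas)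
    {W : Set (LeafModel n)} (hW : IsOpen W) (y : ℝ) :
    IsOpen[F.leafTopology] {x | x ∈ φ.source ∧ (φ x).1 ∈ W ∧ (φ x).2 = y} :=
  TopologicalSpace.isOpen_generateFrom_of_mem ⟨φ, hφ, W, hW, y, rfl⟩

theorem exists_box {φ : OpenPartialHomeomorph M (LeafModel n × ℝ)} {x : M} (hx : x ∈ φ.source)
    {N : Set (LeafModel n × ℝ)} (hN : N ∈ 𝓝 (φ x)) :
    ∃ ε > 0, Metric.ball (φ x).1 ε ×ˢ Metric.ball (φ x).2 ε ⊆ φ.target ∩ N := by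
  obtain ⟨ε, hε, h⟩ := Metric.mem_nhds_iff.1
    (Filter.inter_mem (φ.open_target.mem_nhds (φ.map_source hx)) hN)
  exact ⟨ε, hε, by rwa [ball_prod_same]⟩

theorem leafTopology_le : F.leafTopology ≤ ‹TopologicalSpace M› := by
  intro U hU
  refine (@isOpen_iff_forall_mem_open M F.leafTopology U).2 fun x hx => ?_
  obtain ⟨φ, hφ, hxφ⟩ := F.covers x
  obtain ⟨ε, hε, hbox⟩ := exists_box hxφ
    (φ.symm.continuousAt (φ.map_source hxφ) (by
      rw [φ.left_inv hxφ]; exact hU.mem_nhds hx))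
  refine ⟨_, ?_, F.isOpen_plaque hφ (Metric.isOpen_ball (x := (φ x).1) (ε := ε)) (φ x).2,
    hxφ, Metric.mem_ball_self hε, rfl⟩
  rintro w ⟨hw, hw1, hw2⟩
  have h : φ w ∈ Metric.ball (φ x).1 ε ×ˢ Metric.ball (φ x).2 ε :=
    ⟨hw1, by rw [hw2]; exact Metric.mem_ball_self hε⟩
  simpa [φ.left_inv hw] using (hbox h).2

/-- Along a plaque of `φ` the transverse coordinate in another chart is locally `h y`, hence locally
constant: plaques of one chart stay locally in plaques of the other. -/
theorem continuousOn_leafTopology_symm {φ : OpenPartialHomeomorph M (LeafModel n × ℝ)}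
    (hφ : φ ∈ F.atlas) (y : ℝ) :
    @ContinuousOn _ _ _ F.leafTopology (fun x => φ.symm (x, y)) {x | (x, y) ∈ φ.target} := by
  intro x hx
  refine @ContinuousAt.continuousWithinAt _ _ _ F.leafTopology _ _ _ ?_
  refine TopologicalSpace.tendsto_nhds_generateFrom_iff.2 ?_
  rintro _ ⟨ψ, hψ, W, hW, c, rfl⟩ ⟨hxψ, hxW, hxc⟩
  have hsrc : (x, y) ∈ (φ.symm.trans ψ).source := by
    simp only [OpenPartialHomeomorph.trans_source, OpenPartialHomeomorph.symm_source]
    exact ⟨hx, hxψ⟩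
  obtain ⟨h, hh⟩ := F.transverse φ hφ ψ hψ _ hsrc
  have hc : ContinuousAt (fun x' : LeafModel n => (x', y)) x := by fun_prop
  have hcont : ContinuousAt (φ.symm.trans ψ) (x, y) := (φ.symm.trans ψ).continuousAt hsrc
  have hW' : ∀ᶠ q in 𝓝 (x, y), (φ.symm.trans ψ q).1 ∈ W :=
    hcont.fst.eventually (hW.mem_nhds hxW)
  have hself : (φ.symm.trans ψ (x, y)).2 = h y := hh.self_of_nhds
  filter_upwards [hc.eventually hh, hc.eventually hW',
    hc.eventually ((φ.symm.trans ψ).open_source.mem_nhds hsrc)] with x' h1 h2 h3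
  simp only [OpenPartialHomeomorph.trans_source, OpenPartialHomeomorph.symm_source] at h3
  refine ⟨h3.2, h2, ?_⟩
  exact h1.trans (hself.symm.trans hxc)

theorem leafSetoid_of_plaque {φ : OpenPartialHomeomorph M (LeafModel n × ℝ)}
    (hφ : φ ∈ F.atlas) {y : ℝ} {C : Set (LeafModel n)} (hC : IsPreconnected C)
    (hsub : ∀ x ∈ C, (x, y) ∈ φ.target) {x x' : LeafModel n} (hx : x ∈ C) (hx' : x' ∈ C) :
    F.leafSetoid (φ.symm (x, y)) (φ.symm (x', y)) := by
  have h : @IsPreconnected M F.leafTopology ((fun x => φ.symm (x, y)) '' C) :=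
    @IsPreconnected.image _ _ _ F.leafTopology _ hC _
      (@ContinuousOn.mono _ _ _ F.leafTopology _ _ _
        (F.continuousOn_leafTopology_symm hφ y) hsub)
  exact @connectedComponent_eq M F.leafTopology _ _
    (@IsPreconnected.subset_connectedComponent M F.leafTopology _ _ h ⟨x, hx, rfl⟩ _
      ⟨x', hx', rfl⟩)

theorem leafSetoid_iff {x y : M} : F.leafSetoid x y ↔ y ∈ F.leaf x :=
  Iff.trans ⟨Eq.symm, Eq.symm⟩ (@connectedComponent_eq_iff_mem M F.leafTopology y x)

theorem mem_of_leafSetoid {V : Set M} (hV : @IsClopen M F.leafTopology V) {x y : M}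
    (hxy : F.leafSetoid x y) (hx : x ∈ V) : y ∈ V :=
  @IsClopen.connectedComponent_subset M F.leafTopology _ _ hV hx _ (F.leafSetoid_iff.1 hxy)

/-- The saturation of an open set is open. -/
theorem isOpenMap_mk : IsOpenMap (Quotient.mk F.leafSetoid) := by
  intro U hU
  refine isQuotientMap_quot_mk.isOpen_preimage.1 ?_
  change IsOpen (Quotient.mk F.leafSetoid ⁻¹' (Quotient.mk F.leafSetoid '' U))
  set S := Quotient.mk F.leafSetoid ⁻¹' (Quotient.mk F.leafSetoid '' U) with hS
  have hsat : ∀ x y, F.leafSetoid x y → x ∈ S → y ∈ S := by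
    intro x y hxy hx
    have : Quotient.mk F.leafSetoid x = Quotient.mk F.leafSetoid y := Quotient.sound hxy
    simpa only [hS, Set.mem_preimage, ← this] using hx
  -- The interior of the saturation is itself saturated. It is leafwise closed: if the plaque of `z`
  -- contains an interior point `w`, then all nearby plaques meet `S` near `w`, hence lie in `S`,
  -- and they fill a neighbourhood of `z`.
  have hclopen : @IsClopen M F.leafTopology (interior S) := by
    refine ⟨?_, F.leafTopology_le _ isOpen_interior⟩
    refine (@isOpen_compl_iff M (interior S) F.leafTopology).1 ?_
    refine (@isOpen_iff_forall_mem_open M F.leafTopology _).2 fun z hz => ?_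
    obtain ⟨φ, hφ, hzφ⟩ := F.covers z
    obtain ⟨ε, hε, hbox⟩ := exists_box hzφ Filter.univ_mem
    rw [Set.inter_univ] at hbox
    refine ⟨_, ?_, F.isOpen_plaque hφ (Metric.isOpen_ball (x := (φ z).1) (ε := ε)) (φ z).2,
      hzφ, Metric.mem_ball_self hε, rfl⟩
    rintro w ⟨hw, hw1, hw2⟩ hwS
    refine hz (mem_interior_iff_mem_nhds.2 ?_)
    have hφw : φ w = ((φ w).1, (φ z).2) := by rw [← hw2]
    have hcont : ContinuousAt (fun y : ℝ => φ.symm ((φ w).1, y)) (φ z).2 := by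
      refine ContinuousAt.comp (g := φ.symm) (f := fun y : ℝ => ((φ w).1, y)) ?_ (by fun_prop)
      rw [← hφw]
      exact φ.symm.continuousAt (φ.map_source hw)
    have h1 : ∀ᶠ y in 𝓝 (φ z).2, φ.symm ((φ w).1, y) ∈ S := by
      refine hcont.eventually (Filter.mem_of_superset ?_ interior_subset)
      change interior S ∈ 𝓝 (φ.symm ((φ w).1, (φ z).2))
      rw [← hφw, φ.left_inv hw]
      exact isOpen_interior.mem_nhds hwS
    have hφz := φ.continuousAt hzφ
    filter_upwards [φ.open_source.mem_nhds hzφ, hφz.snd.eventually h1,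
      hφz.fst.eventually (Metric.ball_mem_nhds _ hε),
      hφz.snd.eventually (Metric.ball_mem_nhds _ hε)] with z' hz' h2 h3 h4
    have h5 := F.leafSetoid_of_plaque hφ (y := (φ z').2)
      (Metric.isPreconnected_ball (x := (φ z).1) (r := ε)) (fun x hx => hbox ⟨hx, h4⟩) hw1 h3
    have h6 := hsat _ _ h5 h2
    rwa [Prod.mk.eta, φ.left_inv hz'] at h6
  have hUS : U ⊆ interior S := interior_maximal (fun x hx => ⟨x, hx, rfl⟩) hU
  have : S ⊆ interior S := by
    rintro x ⟨v, hv, hvx⟩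
    exact F.mem_of_leafSetoid hclopen (Quotient.exact hvx) (hUS hv)
  rw [this.antisymm interior_subset]
  exact isOpen_interior

/-- A continuous transversal of a foliation whose leaf space is `ℝ` meets each leaf at most
once. -/
theorem eventually_snd_eq_of_leafSpace_eq (e : F.LeafSpace ≃ₜ ℝ)
    {φ : OpenPartialHomeomorph M (LeafModel n × ℝ)} (hφ : φ ∈ F.atlas) {x : M}
    (hx : x ∈ φ.source) :
    ∀ᶠ z in 𝓝 x, e (Quotient.mk F.leafSetoid z) = e (Quotient.mk F.leafSetoid x) →
      (φ z).2 = (φ x).2 := by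
  obtain ⟨ε, hε, hbox⟩ := exists_box hx Filter.univ_mem
  rw [Set.inter_univ] at hbox
  set π : M → ℝ := fun z => e (Quotient.mk F.leafSetoid z) with hπ
  have hπc : Continuous π := e.continuous.comp continuous_quot_mk
  have hπo : IsOpenMap π := e.isOpenMap.comp F.isOpenMap_mk
  have hball : Metric.ball (φ x).2 ε = Set.Ioo ((φ x).2 - ε) ((φ x).2 + ε) :=
    Real.ball_eq_Ioo _ _
  have hplaque : ∀ x' ∈ Metric.ball (φ x).1 ε, ∀ y ∈ Metric.ball (φ x).2 ε,
      π (φ.symm (x', y)) = π (φ.symm ((φ x).1, y)) := by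
    intro x' hx' y hy
    exact congrArg e (Quotient.sound (F.leafSetoid_of_plaque hφ Metric.isPreconnected_ball
      (fun x hx => hbox ⟨hx, hy⟩) hx' (Metric.mem_ball_self hε)))
  have hcat : ∀ y ∈ Metric.ball (φ x).2 ε,
      ContinuousAt (fun y => φ.symm ((φ x).1, y)) y := by
    intro y hy
    refine ContinuousAt.comp (g := φ.symm) (f := fun y : ℝ => ((φ x).1, y)) ?_ (by fun_prop)
    exact φ.symm.continuousAt (hbox ⟨Metric.mem_ball_self hε, hy⟩)
  -- Restricted to the transversal, `π` is still locally open, because `π` is open on the manifold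
  -- and constant on the plaques of the box.
  have hinj : Set.InjOn (fun y => π (φ.symm ((φ x).1, y))) (Metric.ball (φ x).2 ε) := by
    rw [hball]
    refine injOn_Ioo_of_continuousOn_of_map_nhds ?_ ?_
    · rw [← hball]
      exact fun y hy => (hπc.continuousAt.comp (hcat y hy)).continuousWithinAt
    · rw [← hball]
      intro y hy
      have ht : ((φ x).1, y) ∈ φ.target := hbox ⟨Metric.mem_ball_self hε, hy⟩
      refine (hπo.nhds_le _).trans ?_
      intro T hT
      rw [Filter.mem_map] at hT
      have h1 : ∀ᶠ y' in 𝓝 y, π (φ.symm ((φ x).1, y')) ∈ T := hT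
      rw [Filter.mem_map]
      have hs := φ.map_target ht
      have hcw : ContinuousAt φ (φ.symm ((φ x).1, y)) := φ.continuousAt hs
      have hr := φ.right_inv ht
      have hc1 : Filter.Tendsto (fun w => (φ w).1) (𝓝 (φ.symm ((φ x).1, y))) (𝓝 (φ x).1) := by
        have := hcw.fst
        rwa [ContinuousAt, hr] at this
      have hc2 : Filter.Tendsto (fun w => (φ w).2) (𝓝 (φ.symm ((φ x).1, y))) (𝓝 y) := by
        have := hcw.snd
        rwa [ContinuousAt, hr] at this
      filter_upwards [φ.open_source.mem_nhds hs, hc2.eventually h1,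
        hc1.eventually (Metric.ball_mem_nhds _ hε),
        hc2.eventually (Metric.isOpen_ball.mem_nhds hy)] with w h2 h3 h4 h5
      rw [← hplaque _ h4 _ h5, Prod.mk.eta, φ.left_inv h2] at h3
      exact h3
  have hφx := φ.continuousAt hx
  filter_upwards [φ.open_source.mem_nhds hx, hφx.fst.eventually (Metric.ball_mem_nhds _ hε),
    hφx.snd.eventually (Metric.ball_mem_nhds _ hε)] with z hz h1 h2 heq
  refine hinj h2 (Metric.mem_ball_self hε) ?_
  have h3 := hplaque _ h1 _ h2
  rw [Prod.mk.eta, φ.left_inv hz] at h3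
  simp only [← h3, Prod.mk.eta, φ.left_inv hx]
  exact heq

theorem locallyPathConnectedSpace (F : CodimOneFoliation n M) : LocallyPathConnectedSpace M := by
  choose φ hφ hx using F.covers
  let : ChartedSpace (LeafModel n × ℝ) M :=
    { atlas := Set.range φ
      chartAt := φ
      mem_chart_source := hx
      chart_mem_atlas := fun x => ⟨x, rfl⟩ }
  exact ChartedSpace.locallyPathConnectedSpace (LeafModel n × ℝ) M

/-! ### Lifted foliations and deck transformations -/

section Lift

variable {E : Type u} [TopologicalSpace E] {p : E → M}

theorem continuous_leafTopology_lift (hp : IsLocalHomeomorph p) :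
    Continuous[(F.lift p hp).leafTopology, F.leafTopology] p := by
  refine continuous_generateFrom_iff.2 ?_
  rintro _ ⟨φ, hφ, W, hW, y, rfl⟩
  refine (@isOpen_iff_forall_mem_open E (F.lift p hp).leafTopology _).2 ?_
  rintro x ⟨hx, hxW, hxy⟩
  obtain ⟨e, hxe, rfl⟩ := hp x
  have hmem : e.trans φ ∈ (F.lift e hp).atlas := ⟨φ, hφ, fun z hz => hz.2, fun z _ => rfl⟩
  exact ⟨_, fun w hw => ⟨hw.1.2, hw.2⟩, (F.lift e hp).isOpen_plaque hmem hW y, ⟨hxe, hx⟩, hxW,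
    hxy⟩

/-- Since `p ∘ τ = p`, a chart of the lift precomposed with a local inverse branch of `τ`'s domain,
`e.trans χ`, is again a chart of the lift; so preimages of plaques are unions of plaques. -/
theorem continuous_leafTopology_deck (hp : IsLocalHomeomorph p) {τ : E → E}
    (hτ : IsLocalHomeomorph τ) (hpτ : p ∘ τ = p) :
    Continuous[(F.lift p hp).leafTopology, (F.lift p hp).leafTopology] τ := by
  refine continuous_generateFrom_iff.2 ?_
  rintro _ ⟨χ, ⟨φ, hφ, hχφ, hχ⟩, W, hW, y, rfl⟩
  refine (@isOpen_iff_forall_mem_open E (F.lift p hp).leafTopology _).2 ?_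
  rintro x ⟨hx, hxW, hxy⟩
  obtain ⟨e, hxe, rfl⟩ := hτ x
  have hmem : e.trans χ ∈ (F.lift p hp).atlas := by
    refine ⟨φ, hφ, fun z hz => ?_, fun z hz => ?_⟩
    · rw [← congrFun hpτ z]
      exact hχφ hz.2
    · change χ (e z) = φ (p z)
      rw [← congrFun hpτ z]
      exact hχ hz.2
  exact ⟨_, fun w hw => ⟨hw.1.2, hw.2⟩, (F.lift p hp).isOpen_plaque hmem hW y, ⟨hxe, hx⟩, hxW,
    hxy⟩

theorem leafSetoid_map_of_continuous {E' : Type u} [TopologicalSpace E']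
    (G : CodimOneFoliation n E) (G' : CodimOneFoliation n E') {τ : E → E'}
    (hτ : Continuous[G.leafTopology, G'.leafTopology] τ) {x y : E} (hxy : G.leafSetoid x y) :
    G'.leafSetoid (τ x) (τ y) := by
  rw [leafSetoid_iff] at hxy ⊢
  exact @Continuous.image_connectedComponent_subset _ _ G.leafTopology G'.leafTopology _ hτ x _
    ⟨y, hxy, rfl⟩

/-- Lift `p` through itself, sending `x` to `x'`. A local homeomorphism is all that is used later,
so no inverse of `τ` is constructed. -/
theorem exists_deck (F : CodimOneFoliation n M) [SimplyConnectedSpace E] (hp : IsCoveringMap p) {x x' : E}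
    (hx : p x' = p x) : ∃ τ : E → E, IsLocalHomeomorph τ ∧ p ∘ τ = p ∧ τ x = x' := by
  have := (F.lift p hp.isLocalHomeomorph).locallyPathConnectedSpace
  obtain ⟨τ, ⟨h1, h2⟩, -⟩ := hp.existsUnique_continuousMap_lifts ⟨p, hp.continuous⟩ x x' hx
  refine ⟨τ, ?_, h2, h1⟩
  refine IsLocalHomeomorph.of_comp (g := p) ?_ hp.isLocalHomeomorph τ.continuous
  rw [h2]
  exact hp.isLocalHomeomorph

end Lift

end CodimOneFoliation

/-- The range is open, and also closed: a point over an evenly covered neighbourhood of `x` has a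
fibre coordinate, which is a point over `x`. -/
theorem IsCoveringMap.surjective_of_connectedSpace {E X : Type*} [TopologicalSpace E]
    [TopologicalSpace X] [Nonempty E] [ConnectedSpace X] {p : E → X} (hp : IsCoveringMap p) :
    Function.Surjective p := by
  rw [← Set.range_eq_univ]
  refine IsClopen.eq_univ ⟨⟨?_⟩, hp.isOpenMap.isOpen_range⟩ (Set.range_nonempty p)
  refine isOpen_iff_mem_nhds.2 fun x hx => ?_
  obtain ⟨-, U, hxU, hU, -, H, hH⟩ := hp x
  filter_upwards [hU.mem_nhds hxU]
  rintro _ hv ⟨z, rfl⟩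
  obtain ⟨w, hw⟩ := (H ⟨z, hv⟩).2
  exact hx ⟨w, hw⟩

/-! ### Sets of leaves descending to `M`, and the compact leaf -/

namespace CodimOneFoliation

variable {n : ℕ} {M : Type u} [TopologicalSpace M]

theorem surjective_homeo_mk (F : CodimOneFoliation n M) (e : F.LeafSpace ≃ₜ ℝ) :
    Function.Surjective fun z => e (Quotient.mk F.leafSetoid z) :=
  e.surjective.comp Quotient.mk_surjective

theorem isOpenQuotientMap_homeo_mk (F : CodimOneFoliation n M) (e : F.LeafSpace ≃ₜ ℝ) :
    IsOpenQuotientMap fun z => e (Quotient.mk F.leafSetoid z) :=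
  ⟨F.surjective_homeo_mk e, e.continuous.comp continuous_quot_mk, e.isOpenMap.comp F.isOpenMap_mk⟩

/-- A clopen set of the leaf topology is the preimage of its image in the space of leaves. -/
theorem preimage_image_homeo_mk (F : CodimOneFoliation n M) (e : F.LeafSpace ≃ₜ ℝ) {V : Set M}
    (hV : @IsClopen M F.leafTopology V) :
    (fun z => e (Quotient.mk F.leafSetoid z)) ⁻¹'
      ((fun z => e (Quotient.mk F.leafSetoid z)) '' V) = V := by
  refine (Set.subset_preimage_image _ _).antisymm' ?_
  rintro z ⟨v, hv, hvz⟩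
  exact F.mem_of_leafSetoid hV (Quotient.exact (e.injective hvz)) hv

section Covering

variable {E : Type u} [TopologicalSpace E] {p : E → M}

/-- The set of points over a deck invariant set of leaves of the covering is leafwise clopen as soon
as it is closed. -/
theorem isClopen_leafTopology_image (F : CodimOneFoliation n M) (hp : IsLocalHomeomorph p)
    {T : Set E} (hT : ∀ x y, (F.lift p hp).leafSetoid x y → x ∈ T → y ∈ T)
    (hcl : IsClosed (p '' T)) : @IsClopen M F.leafTopology (p '' T) := by
  refine ⟨@IsClosed.mk M F.leafTopology _ (F.leafTopology_le _ hcl.isOpen_compl), ?_⟩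
  -- Leafwise openness: a small plaque through `p z` lifts to a plaque through `z`, which stays in
  -- the saturated set `T`.
  refine (@isOpen_iff_forall_mem_open M F.leafTopology _).2 ?_
  rintro _ ⟨z, hz, rfl⟩
  obtain ⟨φ, hφ, hzφ⟩ := F.covers (p z)
  obtain ⟨e, hze, rfl⟩ := hp z
  have hmem : e.trans φ ∈ (F.lift e hp).atlas := ⟨φ, hφ, fun z hz => hz.2, fun z _ => rfl⟩
  have hzχ : z ∈ (e.trans φ).source := ⟨hze, hzφ⟩
  obtain ⟨ε, hε, hbox⟩ := exists_box hzχ Filter.univ_mem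
  rw [Set.inter_univ] at hbox
  refine ⟨_, ?_, F.isOpen_plaque hφ (Metric.isOpen_ball (x := (φ (e z)).1) (ε := ε)) (φ (e z)).2,
      hzφ, Metric.mem_ball_self hε, rfl⟩
  rintro w ⟨hw, hw1, hw2⟩
  have hrel := (F.lift e hp).leafSetoid_of_plaque hmem (y := (φ (e z)).2)
    (Metric.isPreconnected_ball (x := (φ (e z)).1) (r := ε))
    (fun x hx => hbox ⟨hx, Metric.mem_ball_self hε⟩) (Metric.mem_ball_self hε) hw1
  have h1 : (e.trans φ).symm ((φ (e z)).1, (φ (e z)).2) = z := (e.trans φ).left_inv hzχ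
  have hφw : φ w = ((φ w).1, (φ (e z)).2) := by rw [← hw2]
  rw [h1, ← hφw] at hrel
  refine ⟨_, hT _ _ hrel hz, ?_⟩
  have ht : φ w ∈ (e.trans φ).target := by
    rw [hφw]
    exact hbox ⟨hw1, Metric.mem_ball_self hε⟩
  rw [OpenPartialHomeomorph.trans_target] at ht
  have h2 : w ∈ e.target := by
    have := ht.2
    rwa [Set.mem_preimage, φ.left_inv hw] at this
  simp [φ.left_inv hw, e.right_inv h2]

/-- Over a locally finite set of leaves of the covering the leaf topology is the topology of `M`. -/
theorem continuousOn_id_leafTopology (F : CodimOneFoliation n M) (hp : IsLocalHomeomorph p)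
    (e : (F.lift p hp).LeafSpace ≃ₜ ℝ) {D : Set ℝ} (hD : ∀ r, ∀ᶠ d in 𝓝 r, d ∈ D → d = r)
    {K : Set M} (hK : p ⁻¹' K = (fun z => e (Quotient.mk (F.lift p hp).leafSetoid z)) ⁻¹' D)
    (hKp : K ⊆ Set.range p) : @ContinuousOn M M _ F.leafTopology id K := by
  intro z hz
  refine TopologicalSpace.tendsto_nhds_generateFrom_iff.2 ?_
  rintro _ ⟨ψ, hψ, W, hW, c, rfl⟩ ⟨hzψ, hzW, hzc⟩
  obtain ⟨z, rfl⟩ := hKp hz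
  simp only [id] at hzψ hzW hzc
  have hπc := ((F.lift p hp).isOpenQuotientMap_homeo_mk e).continuous
  -- Near `z`, a leaf of `D` can only be the leaf of `z`, and that leaf meets a small box only in
  -- the plaque of `z`.
  have key : ∀ᶠ w in 𝓝 z, p w ∈ K → (ψ (p w)).2 = c := by
    obtain ⟨e', hze', he'⟩ := hp z
    have hmem : e'.trans ψ ∈ (F.lift p hp).atlas :=
      ⟨ψ, hψ, fun w hw => by rw [he']; exact hw.2, fun w _ => by simp [he']⟩
    have hzs : z ∈ (e'.trans ψ).source := ⟨hze', by
      change e' z ∈ ψ.source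
      rwa [← he']⟩
    filter_upwards [(F.lift p hp).eventually_snd_eq_of_leafSpace_eq e hmem hzs,
      hπc.continuousAt.eventually (hD _)] with w h1 h2 hwK
    have hwD : w ∈ p ⁻¹' K := hwK
    rw [hK] at hwD
    have h3 := h1 (h2 hwD)
    simp only [OpenPartialHomeomorph.coe_trans, Function.comp_apply, ← he'] at h3
    rw [h3, hzc]
  have key' : ∀ᶠ w in 𝓝 (p z), w ∈ K → (ψ w).2 = c := by
    rw [← hp.map_nhds_eq]
    exact key
  have hψc := ψ.continuousAt hzψ
  filter_upwards [mem_nhdsWithin_of_mem_nhds key',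
    mem_nhdsWithin_of_mem_nhds (ψ.open_source.mem_nhds hzψ),
    mem_nhdsWithin_of_mem_nhds (hψc.fst.eventually (hW.mem_nhds hzW)),
    self_mem_nhdsWithin] with w h1 h2 h3 h4
  exact ⟨h2, h3, h1 h4⟩

/-- A deck transformation acts on the space of leaves. -/
theorem exists_leafSpace_map (F : CodimOneFoliation n M) (hp : IsLocalHomeomorph p)
    (e : (F.lift p hp).LeafSpace ≃ₜ ℝ) {τ : E → E} (hτ : IsLocalHomeomorph τ)
    (hpτ : p ∘ τ = p) :
    ∃ σ : ℝ → ℝ, Continuous σ ∧ ∀ z, σ (e (Quotient.mk (F.lift p hp).leafSetoid z)) =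
      e (Quotient.mk (F.lift p hp).leafSetoid (τ z)) := by
  have hrel : ∀ x y, (F.lift p hp).leafSetoid x y → (F.lift p hp).leafSetoid (τ x) (τ y) :=
    fun x y => leafSetoid_map_of_continuous _ _ (F.continuous_leafTopology_deck hp hτ hpτ)
  refine ⟨fun r => e (Quotient.map τ hrel (e.symm r)), ?_, fun z => by simp⟩
  refine e.continuous.comp (Continuous.comp ?_ e.symm.continuous)
  exact hτ.continuous.quotient_map' hrel

end Covering

/-- In an `ℝ`-covered foliation of a compact manifold, two disjoint closed saturated sets are
separated by a compact leaf. -/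
theorem exists_isCompactLeaf [CompactSpace M] [ConnectedSpace M] (F : CodimOneFoliation n M)
    (hR : F.IsRCovered) {A B : Set M} (hA : IsClosed A) (hB : IsClosed B)
    (hA' : @IsClopen M F.leafTopology A) (hB' : @IsClopen M F.leafTopology B)
    (hAn : A.Nonempty) (hBn : B.Nonempty) (hAB : Disjoint A B) : ∃ x, F.IsCompactLeaf x := by
  obtain ⟨E, _, _, p, hp, ⟨e⟩⟩ := hR
  have hps : Function.Surjective p := hp.surjective_of_connectedSpace
  have hpl := hp.isLocalHomeomorph
  set π : E → ℝ := fun z => e (Quotient.mk (F.lift p hpl).leafSetoid z) with hπ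
  have hπq : IsOpenQuotientMap π := (F.lift p hpl).isOpenQuotientMap_homeo_mk e
  have hpc := F.continuous_leafTopology_lift hpl
  have hπA : π ⁻¹' (π '' (p ⁻¹' A)) = p ⁻¹' A := (F.lift p hpl).preimage_image_homeo_mk e
    (@IsClopen.preimage _ _ (F.lift p hpl).leafTopology F.leafTopology _ hA' _ hpc)
  have hπB : π ⁻¹' (π '' (p ⁻¹' B)) = p ⁻¹' B := (F.lift p hpl).preimage_image_homeo_mk e
    (@IsClopen.preimage _ _ (F.lift p hpl).leafTopology F.leafTopology _ hB' _ hpc)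
  set A₁ := π '' (p ⁻¹' A) with hA₁
  set B₁ := π '' (p ⁻¹' B) with hB₁
  have hA₁c : IsClosed A₁ := by
    rw [← hπq.isQuotientMap.isClosed_preimage, hπA]
    exact hA.preimage hp.continuous
  have hB₁c : IsClosed B₁ := by
    rw [← hπq.isQuotientMap.isClosed_preimage, hπB]
    exact hB.preimage hp.continuous
  have hdisj : Disjoint A₁ B₁ := by
    refine Disjoint.of_preimage hπq.surjective ?_
    rw [hπA, hπB]
    exact hAB.preimage p
  have hD := transitionSet_locally_subsingleton hA₁c hB₁c hdisj
  obtain ⟨d, hd⟩ := transitionSet_nonempty hA₁c hB₁c ((hAn.preimage hps).image π)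
    ((hBn.preimage hps).image π)
  set D := transitionSet A₁ B₁ with hDdef
  have hDc : IsClosed D := isClosed_of_locally_subsingleton hD
  -- Points of one fibre differ by some `τ`. The induced map `σ` of the line pulls `A₁` and `B₁`
  -- back to themselves, so it maps `D` into `D`.
  have hinv : ∀ x x', p x' = p x → x ∈ π ⁻¹' D → x' ∈ π ⁻¹' D := by
    intro x x' hxx hx
    obtain ⟨τ, hτ, hpτ, rfl⟩ := F.exists_deck hp hxx
    obtain ⟨σ, hσ, hσπ⟩ := F.exists_leafSpace_map hpl e hτ hpτ
    have hpre : ∀ C : Set M, π ⁻¹' (π '' (p ⁻¹' C)) = p ⁻¹' C →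
        σ ⁻¹' (π '' (p ⁻¹' C)) = π '' (p ⁻¹' C) := by
      intro C hC
      refine hπq.surjective.preimage_injective ?_
      rw [hC, ← Set.preimage_comp, show σ ∘ π = π ∘ τ from funext hσπ, Set.preimage_comp, hC,
        ← Set.preimage_comp, hpτ]
    have h := map_mem_transitionSet hσ (hpre A hπA) (hpre B hπB) hx
    have h2 : σ (π x) = π (τ x) := hσπ x
    rw [h2] at h
    exact h
  have hpD : p ⁻¹' (p '' (π ⁻¹' D)) = π ⁻¹' D := by
    refine (Set.subset_preimage_image _ _).antisymm' ?_
    rintro x ⟨x₁, hx₁, hxx⟩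
    exact hinv x₁ x hxx.symm hx₁
  have hKc : IsClosed (p '' (π ⁻¹' D)) := by
    rw [← (hp.isQuotientMap hps).isClosed_preimage, hpD]
    exact hDc.preimage hπq.continuous
  -- `K` is compact in `M`, and the identity is continuous on it into the finer leaf topology.
  have hKcompact : @IsCompact M F.leafTopology (p '' (π ⁻¹' D)) := by
    have h := @IsCompact.image_of_continuousOn M M _ F.leafTopology _ _ hKc.isCompact
      (F.continuousOn_id_leafTopology hpl e hD hpD (Set.image_subset_range _ _))
    rwa [Set.image_id] at h
  have hKclopen : @IsClopen M F.leafTopology (p '' (π ⁻¹' D)) := by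
    refine F.isClopen_leafTopology_image hpl (fun x y hxy hx => ?_) hKc
    have : π x = π y := congrArg e (Quotient.sound hxy)
    rwa [Set.mem_preimage, ← this]
  obtain ⟨x, rfl⟩ := hπq.surjective d
  refine ⟨p x, @IsCompact.of_isClosed_subset M F.leafTopology _ _ hKcompact
    (@isClosed_connectedComponent M F.leafTopology _) ?_⟩
  exact @IsClopen.connectedComponent_subset M F.leafTopology _ _ hKclopen ⟨x, hd, rfl⟩

end CodimOneFoliation

/-! ### The Laplace–Beltrami operator in coordinates -/

noncomputable section

variable {n : ℕ}

theorem leafPartial_leafPartial {u : LeafModel n → ℝ} {x : LeafModel n} (hu : ContDiffAt ℝ 2 u x)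
    (i j : Fin n) : leafPartial i (leafPartial j u) x =
      fderiv ℝ (fderiv ℝ u) x (EuclideanSpace.single i 1) (EuclideanSpace.single j 1) := by
  have hd : DifferentiableAt ℝ (fderiv ℝ u) x :=
    (hu.fderiv_right (m := 1) (by norm_num)).differentiableAt (by norm_num)
  have h := hd.hasFDerivAt.clm_apply (hasFDerivAt_const (EuclideanSpace.single j (1 : ℝ)) x)
  unfold leafPartial
  rw [h.fderiv]
  simp

theorem laplaceBeltrami_eq_fderiv (G : LeafModel n → Matrix (Fin n) (Fin n) ℝ)
    {u : LeafModel n → ℝ} {x : LeafModel n} (hu : ContDiffAt ℝ 2 u x) :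
    laplaceBeltrami G u x = ∑ i, ∑ j, (G x)⁻¹ i j *
      (fderiv ℝ (fderiv ℝ u) x (EuclideanSpace.single i 1) (EuclideanSpace.single j 1)
        - ∑ k, christoffelSymbol G x k i j * fderiv ℝ u x (EuclideanSpace.single k 1)) := by
  unfold laplaceBeltrami
  simp only [leafPartial_leafPartial hu]
  rfl

theorem laplaceBeltrami_neg (G : LeafModel n → Matrix (Fin n) (Fin n) ℝ) (u : LeafModel n → ℝ)
    (x : LeafModel n) : laplaceBeltrami G (fun z => -u z) x = -laplaceBeltrami G u x := by
  have h : ∀ (i : Fin n) (v : LeafModel n → ℝ),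
      leafPartial i (fun z => -v z) = fun z => -leafPartial i v z := by
    intro i v
    funext z
    simp [leafPartial, fderiv_fun_neg]
  unfold laplaceBeltrami
  simp only [h, ← Finset.sum_neg_distrib]
  refine Finset.sum_congr rfl fun i _ => Finset.sum_congr rfl fun j _ => ?_
  simp only [mul_neg, Finset.sum_neg_distrib]
  ring

theorem laplaceBeltrami_add_const_mul (G : LeafModel n → Matrix (Fin n) (Fin n) ℝ)
    {u h : LeafModel n → ℝ} {x : LeafModel n} (hu : ContDiffAt ℝ 2 u x) (hh : ContDiffAt ℝ 2 h x)
    (ε : ℝ) : laplaceBeltrami G (fun z => u z + ε * h z) x =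
      laplaceBeltrami G u x + ε * laplaceBeltrami G h x := by
  have hev : fderiv ℝ (fun z => u z + ε * h z) =ᶠ[𝓝 x]
      fun z => fderiv ℝ u z + ε • fderiv ℝ h z := by
    filter_upwards [hu.eventually (by simp), hh.eventually (by simp)] with z h1 h2
    have h1' := h1.differentiableAt (by norm_num)
    have h2' := h2.differentiableAt (by norm_num)
    exact (h1'.hasFDerivAt.add (h2'.hasFDerivAt.const_mul ε)).fderiv
  have hdu : DifferentiableAt ℝ (fderiv ℝ u) x :=
    (hu.fderiv_right (m := 1) (by norm_num)).differentiableAt (by norm_num)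
  have hdh : DifferentiableAt ℝ (fderiv ℝ h) x :=
    (hh.fderiv_right (m := 1) (by norm_num)).differentiableAt (by norm_num)
  have h2 : fderiv ℝ (fderiv ℝ (fun z => u z + ε * h z)) x =
      fderiv ℝ (fderiv ℝ u) x + ε • fderiv ℝ (fderiv ℝ h) x := by
    rw [hev.fderiv_eq]
    exact (hdu.hasFDerivAt.add (hdh.hasFDerivAt.const_smul ε)).fderiv
  rw [laplaceBeltrami_eq_fderiv G hu, laplaceBeltrami_eq_fderiv G hh,
    laplaceBeltrami_eq_fderiv G (hu.add (contDiffAt_const.mul hh)), h2, hev.eq_of_nhds,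
    Finset.mul_sum, ← Finset.sum_add_distrib]
  refine Finset.sum_congr rfl fun i _ => ?_
  rw [Finset.mul_sum, ← Finset.sum_add_distrib]
  refine Finset.sum_congr rfl fun j _ => ?_
  simp only [add_apply, smul_apply, smul_eq_mul, mul_add,
    Finset.sum_add_distrib, mul_left_comm _ ε, ← Finset.mul_sum]
  ring

/-- Restrict to the line `ξ + t • v`. A positive second derivative would make `0` a local minimum as
well as a local maximum, so the restriction would be locally constant and its second derivative
zero. -/
theorem fderiv_fderiv_nonpos_of_isLocalMax {E : Type*} [NormedAddCommGroup E] [NormedSpace ℝ E]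
    {w : E → ℝ} {ξ : E} (hw : ContDiffAt ℝ 2 w ξ) (hmax : IsLocalMax w ξ) (v : E) :
    fderiv ℝ (fderiv ℝ w) ξ v v ≤ 0 := by
  by_contra! hpos
  set c : ℝ → ℝ := fun t => w (ξ + t • v) with hc
  have hline : ∀ t : ℝ, HasDerivAt (fun t : ℝ => ξ + t • v) v t := by
    intro t
    simpa using ((hasDerivAt_id t).smul_const v).const_add ξ
  have hl0 : ContinuousAt (fun t : ℝ => ξ + t • v) 0 := (hline 0).continuousAt
  have hl0' : Filter.Tendsto (fun t : ℝ => ξ + t • v) (𝓝 0) (𝓝 ξ) := by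
    simpa [ContinuousAt] using hl0
  have hderiv : deriv c =ᶠ[𝓝 0] fun t => fderiv ℝ w (ξ + t • v) v := by
    filter_upwards [hl0'.eventually (hw.eventually (by simp))] with t ht
    exact ((ht.differentiableAt (by norm_num)).hasFDerivAt.comp_hasDerivAt t (hline t)).deriv
  have hd : DifferentiableAt ℝ (fderiv ℝ w) (ξ + (0 : ℝ) • v) := by
    simpa using (hw.fderiv_right (m := 1) (by norm_num)).differentiableAt (by norm_num)
  have hdd : deriv (deriv c) 0 = fderiv ℝ (fderiv ℝ w) ξ v v := by
    rw [hderiv.deriv_eq]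
    have h1 := hd.hasFDerivAt.comp_hasDerivAt (0 : ℝ) (hline 0)
    have h2 := h1.clm_apply (hasDerivAt_const (0 : ℝ) v)
    simpa using h2.deriv
  have hmaxc : IsLocalMax c 0 := by
    have : ∀ᶠ t in 𝓝 (0 : ℝ), w (ξ + t • v) ≤ w ξ := hl0'.eventually hmax
    simpa [IsLocalMax, IsMaxFilter, hc] using this
  have hcc : ContinuousAt c 0 := by
    have : ContinuousAt w (ξ + (0 : ℝ) • v) := by simpa using hw.continuousAt
    exact ContinuousAt.comp (f := fun t : ℝ => ξ + t • v) this hl0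
  have hminc : IsLocalMin c 0 :=
    isLocalMin_of_deriv_deriv_pos (hdd ▸ hpos) hmaxc.deriv_eq_zero hcc
  have hconst : c =ᶠ[𝓝 0] fun _ => c 0 := by
    filter_upwards [hmaxc, hminc] with t h1 h2
    exact le_antisymm h1 h2
  have h0 : deriv (deriv c) 0 = 0 := by
    rw [hconst.deriv.deriv_eq]
    simp
  linarith

/-- A positive semidefinite matrix is a sum of rank-one terms `v vᵀ`, so the contraction is a sum of
values `H v v`. -/
theorem sum_mul_bilin_nonpos {A : Matrix (Fin n) (Fin n) ℝ} (hA : A.PosSemidef)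
    (H : LeafModel n →L[ℝ] LeafModel n →L[ℝ] ℝ) (hH : ∀ v, H v v ≤ 0) :
    ∑ i, ∑ j, A i j * H (EuclideanSpace.single i 1) (EuclideanSpace.single j 1) ≤ 0 := by
  obtain ⟨m, v, rfl⟩ := Matrix.posSemidef_iff_eq_sum_vecMulVec.1 hA
  have hV : ∀ k, H (∑ i, v k i • EuclideanSpace.single i 1) (∑ i, v k i • EuclideanSpace.single i 1)
      = ∑ i, ∑ j, v k i * v k j * H (EuclideanSpace.single i 1) (EuclideanSpace.single j 1) := by
    intro k
    simp only [map_sum, map_smul, sum_apply, smul_apply,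
      smul_eq_mul, Finset.mul_sum, mul_assoc]
    rw [Finset.sum_comm]
    exact Finset.sum_congr rfl fun i _ => Finset.sum_congr rfl fun j _ => by ring
  have hsum : ∑ i, ∑ j, (∑ k, Matrix.vecMulVec (v k) (star (v k))) i j *
      H (EuclideanSpace.single i 1) (EuclideanSpace.single j 1) =
      ∑ k, H (∑ i, v k i • EuclideanSpace.single i 1) (∑ i, v k i • EuclideanSpace.single i 1) := by
    simp only [hV, Matrix.sum_apply, Matrix.vecMulVec_apply, star_trivial, Finset.sum_mul]
    rw [Finset.sum_comm' (t' := Finset.univ) (s' := fun _ => Finset.univ) (by simp)]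
    rw [Finset.sum_comm]
    simp_rw [Finset.sum_comm (s := (Finset.univ : Finset (Fin n)))
      (t := (Finset.univ : Finset (Fin m)))]
  rw [hsum]
  exact Finset.sum_nonpos fun k _ => hH _

theorem laplaceBeltrami_nonpos_of_isLocalMax {G : LeafModel n → Matrix (Fin n) (Fin n) ℝ}
    {w : LeafModel n → ℝ} {ξ : LeafModel n} (hG : (G ξ).PosDef) (hw : ContDiffAt ℝ 2 w ξ)
    (hmax : IsLocalMax w ξ) : laplaceBeltrami G w ξ ≤ 0 := by
  rw [laplaceBeltrami_eq_fderiv G hw, hmax.fderiv_eq_zero]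
  simpa using sum_mul_bilin_nonpos hG.inv.posSemidef _ (fderiv_fderiv_nonpos_of_isLocalMax hw hmax)

theorem continuousAt_matrix_inv_apply {X : Type*} [TopologicalSpace X]
    {G : X → Matrix (Fin n) (Fin n) ℝ} {z : X} (hG : ContinuousAt G z) (hz : (G z).det ≠ 0)
    (i j : Fin n) : ContinuousAt (fun x => (G x)⁻¹ i j) z := by
  simp only [Matrix.inv_def, Ring.inverse_eq_inv', Matrix.smul_apply, smul_eq_mul]
  have h1 : Continuous fun A : Matrix (Fin n) (Fin n) ℝ => A.det :=
    Continuous.matrix_det continuous_id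
  have h2 : Continuous fun A : Matrix (Fin n) (Fin n) ℝ => A.adjugate i j :=
    (Continuous.matrix_adjugate continuous_id).matrix_elem i j
  exact ((h1.continuousAt.comp hG).inv₀ hz).mul (h2.continuousAt.comp hG)

theorem continuousAt_laplaceBeltrami {G : LeafModel n → Matrix (Fin n) (Fin n) ℝ}
    {h : LeafModel n → ℝ} {z : LeafModel n} (hG : (G z).PosDef)
    (hG' : ∀ i j, ContDiffAt ℝ 1 (fun x => G x i j) z) (hh : ContDiff ℝ 2 h) :
    ContinuousAt (laplaceBeltrami G h) z := by
  have hinv : ∀ i j, ContinuousAt (fun x => (G x)⁻¹ i j) z := by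
    refine continuousAt_matrix_inv_apply ?_ hG.det_pos.ne'
    exact continuousAt_pi.2 fun i => continuousAt_pi.2 fun j => (hG' i j).continuousAt
  have hpart : ∀ l i j, ContinuousAt (leafPartial l (fun x => G x i j)) z := by
    intro l i j
    exact ((hG' i j).fderiv_right (m := 0) (by norm_num)).continuousAt.clm_apply continuousAt_const
  have hchr : ∀ k i j, ContinuousAt (fun x => christoffelSymbol G x k i j) z := by
    intro k i j
    unfold christoffelSymbol
    refine continuousAt_const.mul (tendsto_finsetSum _ fun l _ => ?_)
    exact (hinv k l).mul (((hpart i j l).add (hpart j i l)).sub (hpart l i j))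
  have hc1 : Continuous (fderiv ℝ h) := hh.continuous_fderiv (by norm_num)
  have hc2 : Continuous (fderiv ℝ (fderiv ℝ h)) :=
    (hh.fderiv_right (m := 1) (by norm_num)).continuous_fderiv (by norm_num)
  rw [show laplaceBeltrami G h = fun x => _ from
    funext fun x => laplaceBeltrami_eq_fderiv G hh.contDiffAt]
  refine tendsto_finsetSum _ fun i _ => tendsto_finsetSum _ fun j _ => ?_
  refine (hinv i j).mul (ContinuousAt.sub ?_ ?_)
  · fun_prop
  · refine tendsto_finsetSum _ fun k _ => (hchr k i j).mul ?_
    fun_prop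

/-! ### Hopf's lemma and the strong maximum principle -/

/-- The barrier of Hopf's lemma at a point `z` of a sphere centred at `a`. -/
def hopfBarrier (a z : LeafModel n) (β : ℝ) (x : LeafModel n) : ℝ :=
  (‖z - a‖ ^ 2 - ‖x - a‖ ^ 2) + β * (‖z - a‖ ^ 2 - ‖x - a‖ ^ 2) ^ 2 - ‖x - z‖ ^ 2

theorem contDiff_hopfBarrier (a z : LeafModel n) (β : ℝ) : ContDiff ℝ 2 (hopfBarrier a z β) := by
  have h : ∀ b : LeafModel n, ContDiff ℝ 2 (fun x : LeafModel n => ‖x - b‖ ^ 2) := fun b =>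
    (contDiff_id.sub contDiff_const).norm_sq ℝ
  have ha := h a
  have hz := h z
  unfold hopfBarrier
  fun_prop

theorem hasFDerivAt_norm_sub_sq (b x : LeafModel n) :
    HasFDerivAt (fun x : LeafModel n => ‖x - b‖ ^ 2) ((2 : ℝ) • innerSL ℝ (x - b)) x := by
  have := ((hasFDerivAt_id x).sub_const b).norm_sq
  rw [ofNat_smul_eq_nsmul ℝ 2]
  simpa using this

theorem fderiv_hopfBarrier (a z : LeafModel n) (β : ℝ) (x : LeafModel n) :
    fderiv ℝ (hopfBarrier a z β) x =
      (-2 * (1 + 2 * β * (‖z - a‖ ^ 2 - ‖x - a‖ ^ 2))) • innerSL ℝ (x - a)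
        - (2 : ℝ) • innerSL ℝ (x - z) := by
  have hs := (hasFDerivAt_norm_sub_sq a x).const_sub (‖z - a‖ ^ 2)
  have h := (hs.add ((hs.pow 2).const_mul β)).sub (hasFDerivAt_norm_sub_sq z x)
  refine h.fderiv.trans ?_
  ext v
  simp
  ring

theorem fderiv_fderiv_hopfBarrier (a z : LeafModel n) (β : ℝ) (v w : LeafModel n) :
    fderiv ℝ (fderiv ℝ (hopfBarrier a z β)) z v w =
      β * (8 * (inner ℝ (z - a) v * inner ℝ (z - a) w)) - 4 * inner ℝ v w := by
  rw [show fderiv ℝ (hopfBarrier a z β) = _ from funext (fderiv_hopfBarrier a z β)]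
  have hs := (hasFDerivAt_norm_sub_sq a z).const_sub (‖z - a‖ ^ 2)
  have hc : HasFDerivAt (fun x => -2 * (1 + 2 * β * (‖z - a‖ ^ 2 - ‖x - a‖ ^ 2)))
    _ z := ((hs.const_mul (2 * β)).const_add 1).const_mul (-2)
  obtain ⟨B, hB⟩ : ∃ B : LeafModel n →L[ℝ] LeafModel n →L[ℝ] ℝ, ∀ v, B v = innerSL ℝ v :=
    ⟨innerSL ℝ, fun _ => rfl⟩
  have hi : ∀ b : LeafModel n, HasFDerivAt (fun x => innerSL ℝ (x - b)) B z := fun b => by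
    simp_rw [← hB]
    exact B.hasFDerivAt.comp z ((hasFDerivAt_id z).sub_const b)
  have h := (hc.smul (hi a)).sub ((hi z).const_smul (2 : ℝ))
  refine (DFunLike.congr_fun (DFunLike.congr_fun h.fderiv v) w).trans ?_
  simp [hB, inner_sub_left]
  ring

/-- The square in the barrier vanishes to second order at `z`, so it affects only the Hessian there.
It contributes `8 * β * Q`, with `Q > 0` the squared length of `z - a` in the inverse metric;
everything else is the constant `C`, and a large `β` wins. -/
theorem exists_laplaceBeltrami_hopfBarrier_pos {G : LeafModel n → Matrix (Fin n) (Fin n) ℝ}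
    {a z : LeafModel n} (hG : (G z).PosDef) (haz : a ≠ z) :
    ∃ β > 0, 0 < laplaceBeltrami G (hopfBarrier a z β) z := by
  set Q : ℝ := ∑ i, ∑ j, (G z)⁻¹ i j * ((z - a) i * (z - a) j) with hQ
  have hQpos : 0 < Q := by
    have hne : (z - a).ofLp ≠ 0 := by
      intro h
      exact haz (sub_eq_zero.1 ((WithLp.ofLp_eq_zero 2).1 h)).symm
    have := hG.inv.dotProduct_mulVec_pos hne
    refine this.trans_eq ?_
    simp only [hQ, dotProduct, Matrix.mulVec, Finset.mul_sum, star_trivial]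
    exact Finset.sum_congr rfl fun i _ => Finset.sum_congr rfl fun j _ => by ring
  set C : ℝ := ∑ i, ∑ j, (G z)⁻¹ i j *
    (-(4 * inner ℝ (EuclideanSpace.single i (1 : ℝ)) (EuclideanSpace.single j (1 : ℝ))) -
      ∑ k, christoffelSymbol G z k i j * (-2 * (z - a) k)) with hC
  have hL : ∀ β, laplaceBeltrami G (hopfBarrier a z β) z = β * (8 * Q) + C := by
    intro β
    rw [laplaceBeltrami_eq_fderiv G (contDiff_hopfBarrier a z β).contDiffAt, hQ, hC]
    simp only [Finset.mul_sum, ← Finset.sum_add_distrib]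
    refine Finset.sum_congr rfl fun i _ => Finset.sum_congr rfl fun j _ => ?_
    rw [fderiv_fderiv_hopfBarrier, fderiv_hopfBarrier]
    simp [EuclideanSpace.inner_single_right, inner_sub_left]
    ring
  refine ⟨(|C| + 1) / (8 * Q), by positivity, ?_⟩
  rw [hL, div_mul_cancel₀ _ (by positivity)]
  linarith [neg_abs_le C]

/-- A harmonic function which is less than its supremum `m` on a ball does not take the value `m` at
a point of the bounding sphere in the interior of its domain. -/
theorem lt_of_mem_sphere_of_laplaceBeltrami_eq_zero {G : LeafModel n → Matrix (Fin n) (Fin n) ℝ}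
    {u : LeafModel n → ℝ} {U : Set (LeafModel n)} (hU : IsOpen U)
    (hG : ∀ x ∈ U, (G x).PosDef) (hG' : ∀ x ∈ U, ∀ i j, ContDiffAt ℝ 1 (fun z => G z i j) x)
    (hu : ∀ x ∈ U, ContDiffAt ℝ 2 u x) (hL : ∀ x ∈ U, laplaceBeltrami G u x = 0) {m : ℝ}
    (hm : ∀ x ∈ U, u x ≤ m) {a z : LeafModel n} (hz : z ∈ U) (haz : a ≠ z)
    (hlt : ∀ x ∈ U, ‖x - a‖ < ‖z - a‖ → u x < m) : u z < m := by
  refine lt_of_le_of_ne (hm z hz) fun huz => ?_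
  obtain ⟨β, hβ, hLh⟩ := exists_laplaceBeltrami_hopfBarrier_pos (hG z hz) haz
  set h := hopfBarrier a z β with hh
  have hhC : ContDiff ℝ 2 h := contDiff_hopfBarrier a z β
  have hhz : h z = 0 := by simp [hh, hopfBarrier]
  have hs : ContinuousAt (fun x => 1 + β * (‖z - a‖ ^ 2 - ‖x - a‖ ^ 2)) z := by fun_prop
  obtain ⟨δ, hδ, hball⟩ := Metric.nhds_basis_closedBall.mem_iff.1 (Filter.inter_mem
    (hU.mem_nhds hz) (Filter.inter_mem
      ((continuousAt_laplaceBeltrami (hG z hz) (hG' z hz) hhC).eventually (lt_mem_nhds hLh))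
      (hs.eventually (lt_mem_nhds (show (0 : ℝ) < _ by simp)))))
  -- Points where `u = m` lie outside the open ball about `a`. There `s = ‖z - a‖ ^ 2 - ‖x - a‖ ^ 2
  -- ≤ 0`, so `s * (1 + β * s) ≤ 0` for small `δ`, and the term `-‖x - z‖ ^ 2` makes `h` strictly
  -- negative.
  have hneg : ∀ x ∈ Metric.closedBall z δ, x ≠ z → u x = m → h x < 0 := by
    intro x hx hxz hux
    obtain ⟨hxU, -, hx1⟩ := hball hx
    have hx1' : 0 < 1 + β * (‖z - a‖ ^ 2 - ‖x - a‖ ^ 2) := hx1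
    have h1 : ‖z - a‖ ≤ ‖x - a‖ := by
      by_contra! hcon
      exact (hlt x hxU hcon).ne hux
    have h2 : ‖z - a‖ ^ 2 - ‖x - a‖ ^ 2 ≤ 0 :=
      sub_nonpos.2 (pow_le_pow_left₀ (norm_nonneg _) h1 2)
    have h3 : 0 < ‖x - z‖ ^ 2 := by
      have := norm_pos_iff.2 (sub_ne_zero.2 hxz)
      positivity
    have h4 := mul_nonpos_of_nonpos_of_nonneg h2 hx1'.le
    simp only [hh, hopfBarrier]
    linarith
  have hucont : ContinuousOn u (Metric.closedBall z δ) := fun x hx =>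
    (hu x (hball hx).1).continuousAt.continuousWithinAt
  have hsub : Metric.sphere z δ ⊆ Metric.closedBall z δ := Metric.sphere_subset_closedBall
  -- Where `h < 0` any `ε` works. On the compact rest of the sphere `u` stays below `m` by a
  -- positive gap, and `ε` is that gap divided by `max h + 1`, the `1` avoiding a zero denominator.
  obtain ⟨ε, hε, hsphere⟩ : ∃ ε > 0, ∀ x ∈ Metric.sphere z δ, u x + ε * h x < m := by
    have hK : IsCompact (Metric.sphere z δ ∩ {x | 0 ≤ h x}) :=
      (isCompact_sphere z δ).inter_right (isClosed_le continuous_const hhC.continuous)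
    rcases (Metric.sphere z δ ∩ {x | 0 ≤ h x}).eq_empty_or_nonempty with hemp | hne
    · refine ⟨1, one_pos, fun x hx => ?_⟩
      have : h x < 0 := by
        by_contra! hcon
        exact Set.notMem_empty x (hemp ▸ ⟨hx, hcon⟩)
      linarith [hm x (hball (hsub hx)).1]
    · obtain ⟨x₁, hx₁, hmax₁⟩ := hK.exists_isMaxOn hne
        (hucont.mono (Set.inter_subset_left.trans hsub))
      obtain ⟨x₂, hx₂, hmax₂⟩ := hK.exists_isMaxOn hne hhC.continuous.continuousOn
      have hx₁m : u x₁ < m := by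
        refine lt_of_le_of_ne (hm x₁ (hball (hsub hx₁.1)).1) fun heq => ?_
        refine (hneg x₁ (hsub hx₁.1) ?_ heq).not_ge hx₁.2
        rintro rfl
        simp only [Metric.mem_sphere, dist_self, Set.mem_inter_iff] at hx₁
        exact hδ.ne hx₁.1
      have hh₂ : 0 ≤ h x₂ := hx₂.2
      have hd : 0 < m - u x₁ := sub_pos.2 hx₁m
      refine ⟨(m - u x₁) / (h x₂ + 1), by positivity, fun x hx => ?_⟩
      rcases lt_or_ge (h x) 0 with hhx | hhx
      · have : (m - u x₁) / (h x₂ + 1) * h x < 0 := mul_neg_of_pos_of_neg (by positivity) hhx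
        linarith [hm x (hball (hsub hx)).1]
      · have h1 : u x ≤ u x₁ := hmax₁ ⟨hx, hhx⟩
        have h2 : h x ≤ h x₂ := hmax₂ ⟨hx, hhx⟩
        have h3 : (m - u x₁) / (h x₂ + 1) * h x < m - u x₁ := by
          rw [div_mul_eq_mul_div, div_lt_iff₀ (by positivity)]
          exact mul_lt_mul_of_pos_left (by linarith) hd
        linarith
  -- The perturbed function equals `m` at `z` and is smaller on the sphere, so it has an interior
  -- maximum `ξ`, where its Laplacian `ε * Δh` would be both positive and nonpositive.
  obtain ⟨ξ, hξ, hmax⟩ := (isCompact_closedBall z δ).exists_isMaxOn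
    ⟨z, Metric.mem_closedBall_self hδ.le⟩
    (hucont.add (continuous_const.mul hhC.continuous : Continuous fun x => ε * h x).continuousOn)
  have hξz : m ≤ u ξ + ε * h ξ := by
    have h1 : u z + ε * h z ≤ u ξ + ε * h ξ := hmax (Metric.mem_closedBall_self hδ.le)
    rwa [hhz, mul_zero, add_zero, huz] at h1
  have hξb : ξ ∈ Metric.ball z δ := by
    refine lt_of_le_of_ne (Metric.mem_closedBall.1 hξ) fun heq => ?_
    exact (hsphere ξ heq).not_ge hξz
  obtain ⟨hξU, hξL, -⟩ := hball hξ
  have hlocal : IsLocalMax (fun x => u x + ε * h x) ξ :=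
    hmax.isLocalMax (Filter.mem_of_superset (Metric.isOpen_ball.mem_nhds hξb)
      Metric.ball_subset_closedBall)
  have h1 := laplaceBeltrami_nonpos_of_isLocalMax (hG ξ hξU)
    ((hu ξ hξU).add (contDiffAt_const.mul hhC.contDiffAt)) hlocal
  rw [laplaceBeltrami_add_const_mul G (hu ξ hξU) hhC.contDiffAt, hL ξ hξU, zero_add] at h1
  exact h1.not_gt (mul_pos hε hξL)

/-- The strong maximum principle. -/
theorem eventually_eq_of_laplaceBeltrami_eq_zero {G : LeafModel n → Matrix (Fin n) (Fin n) ℝ}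
    {u : LeafModel n → ℝ} {U : Set (LeafModel n)} (hU : IsOpen U)
    (hG : ∀ x ∈ U, (G x).PosDef) (hG' : ∀ x ∈ U, ∀ i j, ContDiffAt ℝ 1 (fun z => G z i j) x)
    (hu : ∀ x ∈ U, ContDiffAt ℝ 2 u x) (hL : ∀ x ∈ U, laplaceBeltrami G u x = 0) {m : ℝ}
    (hm : ∀ x ∈ U, u x ≤ m) {x₀ : LeafModel n} (hx₀ : x₀ ∈ U) (hux₀ : u x₀ = m) :
    ∀ᶠ x in 𝓝 x₀, u x = m := by
  obtain ⟨R, hR, hball⟩ := Metric.isOpen_iff.1 hU x₀ hx₀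
  -- With `a` within `R / 2` of `x₀`, the closed ball about `a` through `x₀` stays in `U`.
  filter_upwards [Metric.ball_mem_nhds x₀ (half_pos hR)] with a ha
  by_contra hua
  have hsub : Metric.closedBall a (dist x₀ a) ⊆ U := by
    intro x hx
    refine hball (Metric.mem_ball.2 ?_)
    have h1 := dist_triangle x a x₀
    have h2 := Metric.mem_closedBall.1 hx
    have h3 := Metric.mem_ball.1 ha
    rw [dist_comm x₀ a] at h2
    linarith
  have hucont : ContinuousOn u (Metric.closedBall a (dist x₀ a)) := fun x hx =>
    (hu x (hsub hx)).continuousAt.continuousWithinAt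
  have hK : IsCompact (Metric.closedBall a (dist x₀ a) ∩ u ⁻¹' {m}) :=
    (isCompact_closedBall _ _).of_isClosed_subset
      (hucont.preimage_isClosed_of_isClosed Metric.isClosed_closedBall isClosed_singleton)
      Set.inter_subset_left
  -- `z` is a point of the maximum set nearest to `a`, so `u < m` strictly inside the sphere about
  -- `a` through `z`, contradicting Hopf's lemma.
  obtain ⟨z, ⟨hz, huz⟩, hmin⟩ := hK.exists_isMinOn ⟨x₀, Metric.mem_closedBall.2 le_rfl, hux₀⟩
    (f := fun x => dist x a) (by fun_prop)
  refine (lt_of_mem_sphere_of_laplaceBeltrami_eq_zero hU hG hG' hu hL hm (hsub hz) (a := a) ?_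
    fun x hx hxa => ?_).ne huz
  · rintro rfl
    exact hua huz
  · refine lt_of_le_of_ne (hm x hx) fun hux => ?_
    rw [← dist_eq_norm, ← dist_eq_norm] at hxa
    have hx' : x ∈ Metric.closedBall a (dist x₀ a) :=
      Metric.mem_closedBall.2 (hxa.le.trans (Metric.mem_closedBall.1 hz))
    have : dist z a ≤ dist x a := hmin ⟨hx', hux⟩
    linarith

end

/-! ### Extremal sets of leafwise harmonic functions, and the conclusion -/

namespace LeafwiseMetric

variable {n : ℕ} {M : Type u} [TopologicalSpace M] {F : CodimOneFoliation n M}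

theorem IsLeafwiseHarmonic.neg {g : LeafwiseMetric F} {f : M → ℝ} (hf : g.IsLeafwiseHarmonic f) :
    g.IsLeafwiseHarmonic fun x => -f x := by
  refine ⟨hf.1.neg, fun φ hφ q hq => ⟨(hf.2 φ hφ q hq).1.neg, ?_⟩⟩
  rw [laplaceBeltrami_neg, (hf.2 φ hφ q hq).2, neg_zero]

/-- The maximum set of a leafwise harmonic function is saturated. -/
theorem IsLeafwiseHarmonic.isClopen_setOf_eq {g : LeafwiseMetric F} {f : M → ℝ}
    (hf : g.IsLeafwiseHarmonic f) {m : ℝ} (hm : ∀ x, f x ≤ m) :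
    @IsClopen M F.leafTopology {x | f x = m} := by
  refine ⟨@IsClosed.mk M F.leafTopology _ (F.leafTopology_le _
    (isClosed_eq hf.1 continuous_const).isOpen_compl), ?_⟩
  refine (@isOpen_iff_forall_mem_open M F.leafTopology _).2 fun x hx => ?_
  obtain ⟨φ, hφ, hxφ⟩ := F.covers x
  have hU : IsOpen {x' : LeafModel n | (x', (φ x).2) ∈ φ.target} :=
    φ.open_target.preimage (by fun_prop)
  have hmax := eventually_eq_of_laplaceBeltrami_eq_zero
    (G := fun x' => g.coeff φ (x', (φ x).2)) (u := fun x' => f (φ.symm (x', (φ x).2))) hU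
    (fun x' hx' => g.posDef φ hφ _ hx') (fun x' hx' i j => (g.regular φ hφ i j).1 _ hx')
    (fun x' hx' => (hf.2 φ hφ _ hx').1) (fun x' hx' => (hf.2 φ hφ _ hx').2) (fun x' _ => hm _)
    (x₀ := (φ x).1) (φ.map_source hxφ) (by
      simp only [Prod.mk.eta, φ.left_inv hxφ]
      exact hx)
  obtain ⟨ε, hε, hball⟩ := Metric.eventually_nhds_iff_ball.1 hmax
  refine ⟨_, ?_, F.isOpen_plaque hφ (Metric.isOpen_ball (x := (φ x).1) (ε := ε)) (φ x).2, hxφ,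
    Metric.mem_ball_self hε, rfl⟩
  rintro w ⟨hw, hw1, hw2⟩
  have := hball _ hw1
  rwa [← hw2, Prod.mk.eta, φ.left_inv hw] at this

end LeafwiseMetric

theorem mainTheorem7 {n : ℕ} {M : Type u} [TopologicalSpace M] [T2Space M] [CompactSpace M]
    [ConnectedSpace M] (F : CodimOneFoliation n M) (g : LeafwiseMetric F)
    (hR : F.IsRCovered) (hc : ∀ x : M, ¬ F.IsCompactLeaf x) :
    (∀ f : M → ℝ, g.IsLeafwiseHarmonic f → ∃ c : ℝ, ∀ x : M, f x = c) ∧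
      g.LiouvilleProperty := by
  have hconst : ∀ f : M → ℝ, g.IsLeafwiseHarmonic f → ∃ c : ℝ, ∀ x : M, f x = c := by
    intro f hf
    obtain ⟨x₁, -, hx₁⟩ := isCompact_univ.exists_isMaxOn Set.univ_nonempty hf.1.continuousOn
    obtain ⟨x₂, -, hx₂⟩ := isCompact_univ.exists_isMinOn Set.univ_nonempty hf.1.continuousOn
    have hmax : ∀ x, f x ≤ f x₁ := fun x => hx₁ (Set.mem_univ x)
    have hmin : ∀ x, f x₂ ≤ f x := fun x => hx₂ (Set.mem_univ x)
    by_cases heq : f x₁ = f x₂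
    · exact ⟨f x₂, fun x => le_antisymm (heq ▸ hmax x) (hmin x)⟩
    -- The minimum set of `f` is the maximum set of `-f`.
    have hB := hf.neg.isClopen_setOf_eq (m := -f x₂) fun x => neg_le_neg (hmin x)
    simp only [neg_inj] at hB
    obtain ⟨x, hx⟩ := F.exists_isCompactLeaf hR (isClosed_eq hf.1 continuous_const)
      (isClosed_eq hf.1 continuous_const) (hf.isClopen_setOf_eq hmax) hB ⟨x₁, rfl⟩ ⟨x₂, rfl⟩
      (Set.disjoint_left.2 fun x h1 h2 => heq (h1.symm.trans h2))
    exact absurd hx (hc x)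
  refine ⟨hconst, fun f hf x y _ => ?_⟩
  obtain ⟨c, hc⟩ := hconst f hf
  rw [hc, hc]
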